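/- All spaces and algebras are over $\mathbb{C}$. For a discrete group $G$, $\ell^1(G)$ is the Banach algebra of absolutely summable functions $G\to\mathbb{C}$ with the $\ell^1$-norm and convolution $(f*g)(x)=\sum_{y\in G} f(y)\,g(y^{-1}x)$. A Banach bimodule $X$ over a Banach algebra $A$ is a Banach space with commuting associative left and right actions of $A$ that are bounded bilinear maps (the actions need not be unital). The dual $X^*$ is a Banach $A$-bimodule via $\langle x,a\cdot\varphi\rangle=\langle x\cdot a,\varphi\rangle$ and $\langle x,\varphi\cdot a\rangle=\langle a\cdot x,\varphi\rangle$. For a Banach $A$-bimodule $Y$ let $\mathcal{BL}^n(A,Y)$ be the space of bounded $n$-linear maps from $A$ to $Y$, and let $\delta^n:\mathcal{BL}^n(A,Y)\to\mathcal{BL}^{n+1}(A,Y)$ be the Hochschild coboundary $$(\delta^nT)(a_1,\dots,a_{n+1})=a_1\cdot T(a_2,\dots,a_{n+1})+\sum_{k=1}^n(-1)^kT(a_1,\dots,a_ka_{k+1},\dots,a_{n+1})+(-1)^{n+1}T(a_1,\dots,a_n)\cdot a_{n+1}.$$ For $n\ge 1$ put $\mathcal{Z}^n(A,Y)=\ker\delta^n$,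 $\mathcal{B}^n(A,Y)=\operatorname{ran}\delta^{n-1}$ and $$\mathcal{H}^n_{app}(A,Y)=\mathcal{Z}^n(A,Y)\big/\overline{\mathcal{B}^n(A,Y)},$$ where the closure is taken in the strong topology of $\mathcal{BL}^n(A,Y)$, in which $T_i\to T$ if and only if $\|(T_i-T)(a_1,\dots,a_n)\|\to 0$ for all $a_1,\dots,a_n\in A$. Proposition. Let $H$ be a subgroup of a discrete group $G$. If $\mathcal{H}^2_{app}(\ell^1(G),X^*)=\{0\}$ for all Banach $\ell^1(G)$-bimodules $X$, then $\mathcal{H}^2_{app}(\ell^1(H),X^*)=\{0\}$ for all Banach $\ell^1(H)$-bimodules $X$. -/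

import Mathlib

open scoped ENNReal Topology

universe u v

noncomputable section

/-! ### The convolution algebra `ℓ¹(G)` of a discrete group -/

/-- The Banach space `ℓ¹(G)` of absolutely summable functions `G → ℂ`. -/
abbrev L1 (G : Type u) : Type u := lp (fun _ : G => ℂ) 1

namespace L1

variable {G : Type u}

lemma summable_norm (f : L1 G) : Summable fun x => ‖f x‖ := by
  simpa using (lp.memℓp f).summable (by simp)

lemma norm_eq (f : L1 G) : ‖f‖ = ∑' x, ‖f x‖ := by
  simpa using lp.norm_eq_tsum_rpow (p := 1) (by simp) f

variable [Group G]

/-- The shear `(x, y) ↦ (y, y⁻¹ x)`. -/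
def shear (G : Type u) [Group G] : G × G ≃ G × G where
  toFun p := (p.2, p.2⁻¹ * p.1)
  invFun q := (q.1 * q.2, q.1)
  left_inv p := by simp
  right_inv q := by simp

lemma summable_shear_norm (f g : L1 G) :
    Summable fun p : G × G => ‖f p.2 * g (p.2⁻¹ * p.1)‖ := by
  have h : Summable fun q : G × G => ‖f q.1 * g q.2‖ := by
    simpa using f.summable_norm.mul_norm g.summable_norm
  exact (shear G).summable_iff.mpr h

lemma summable_conv_norm (f g : L1 G) (x : G) : Summable fun y => ‖f y * g (y⁻¹ * x)‖ :=
  (summable_shear_norm f g).prod_factor x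

lemma summable_conv (f g : L1 G) (x : G) : Summable fun y => f y * g (y⁻¹ * x) :=
  (summable_conv_norm f g x).of_norm

lemma summable_norm_conv (f g : L1 G) :
    Summable fun x => ‖∑' y, f y * g (y⁻¹ * x)‖ :=
  Summable.of_nonneg_of_le (fun _ => norm_nonneg _)
    (fun x => norm_tsum_le_tsum_norm (summable_conv_norm f g x)) (summable_shear_norm f g).prod

/-- Convolution: `(f * g)(x) = ∑ y, f(y) g(y⁻¹ x)`. -/
instance : Mul (L1 G) where
  mul f g := ⟨fun x => ∑' y, f y * g (y⁻¹ * x),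
    memℓp_gen (by simpa using summable_norm_conv f g)⟩

lemma mul_apply (f g : L1 G) (x : G) : (f * g) x = ∑' y, f y * g (y⁻¹ * x) := rfl

lemma norm_mul_le' (f g : L1 G) : ‖f * g‖ ≤ ‖f‖ * ‖g‖ := by
  have h : Summable fun q : G × G => ‖f q.1 * g q.2‖ := by
    simpa using f.summable_norm.mul_norm g.summable_norm
  calc ‖f * g‖ = ∑' x, ‖∑' y, f y * g (y⁻¹ * x)‖ := norm_eq _
    _ ≤ ∑' x, ∑' y, ‖f y * g (y⁻¹ * x)‖ :=
        (summable_norm_conv f g).tsum_le_tsum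
          (fun x => norm_tsum_le_tsum_norm (summable_conv_norm f g x))
          (summable_shear_norm f g).prod
    _ = ∑' p : G × G, ‖f p.2 * g (p.2⁻¹ * p.1)‖ := (summable_shear_norm f g).tsum_prod.symm
    _ = ∑' q : G × G, ‖f q.1 * g q.2‖ :=
        (shear G).tsum_eq (fun q : G × G => ‖f q.1 * g q.2‖)
    _ = ‖f‖ * ‖g‖ := by
        rw [norm_eq, norm_eq, h.tsum_prod]
        simp only [norm_mul, tsum_mul_left, tsum_mul_right]

lemma mul_assoc' (f g k : L1 G) : f * g * k = f * (g * k) := by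
  ext x
  have hs : Summable fun p : G × G => f p.2 * g (p.2⁻¹ * p.1) * k (p.1⁻¹ * x) := by
    refine Summable.of_norm_bounded ((summable_shear_norm f g).mul_right ‖k‖) fun p => ?_
    rw [norm_mul]
    gcongr
    exact lp.norm_apply_le_norm one_ne_zero k _
  calc (f * g * k) x
      = ∑' z, ∑' y, f y * g (y⁻¹ * z) * k (z⁻¹ * x) := by
        simp only [mul_apply, tsum_mul_right]
    _ = ∑' y, ∑' z, f y * g (y⁻¹ * z) * k (z⁻¹ * x) :=
        Summable.tsum_comm (f := fun y z => f y * g (y⁻¹ * z) * k (z⁻¹ * x)) hs.prod_symm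
    _ = ∑' y, f y * ∑' z, g z * k (z⁻¹ * (y⁻¹ * x)) := by
        refine tsum_congr fun y => ?_
        rw [← tsum_mul_left, ← (Equiv.mulLeft y).tsum_eq]
        refine tsum_congr fun z => ?_
        simp [mul_assoc]
    _ = (f * (g * k)) x := rfl

/-- `ℓ¹(G)` is a Banach algebra under convolution. -/
instance : NonUnitalNormedRing (L1 G) where
  __ := (inferInstance : NormedAddCommGroup (L1 G))
  mul f g := f * g
  left_distrib f g k := by
    ext x
    simp only [lp.coeFn_add, Pi.add_apply, mul_apply, mul_add]
    exact (summable_conv f g x).tsum_add (summable_conv f k x)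
  right_distrib f g k := by
    ext x
    simp only [lp.coeFn_add, Pi.add_apply, mul_apply, add_mul]
    exact (summable_conv f k x).tsum_add (summable_conv g k x)
  zero_mul f := by ext x; simp [mul_apply]
  mul_zero f := by ext x; simp [mul_apply]
  mul_assoc := mul_assoc'
  norm_mul_le := norm_mul_le'

instance : IsScalarTower ℂ (L1 G) (L1 G) where
  smul_assoc c f g := by
    ext x
    simp only [smul_eq_mul, lp.coeFn_smul, Pi.smul_apply, mul_apply, mul_assoc, tsum_mul_left]

instance : SMulCommClass ℂ (L1 G) (L1 G) where
  smul_comm c f g := by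
    ext x
    simp only [smul_eq_mul, lp.coeFn_smul, Pi.smul_apply, mul_apply, mul_left_comm _ c,
      tsum_mul_left]

end L1

/-! ### Banach bimodules -/

/-- A Banach `A`-bimodule structure on `X`: commuting left and right actions
`(a, x) ↦ a · x` and `(a, x) ↦ x · a` that are bounded bilinear maps. No unit is required in
`A`, and no unitality of the actions. -/
structure BanachBimodule (A : Type u) (X : Type v)
    [NonUnitalNormedRing A] [NormedSpace ℂ A] [NormedAddCommGroup X] [NormedSpace ℂ X] where
  /-- `left a x = a · x` -/
  left : A →L[ℂ] X →L[ℂ] X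
  /-- `right a x = x · a` -/
  right : A →L[ℂ] X →L[ℂ] X
  left_mul : ∀ a b x, left (a * b) x = left a (left b x)
  right_mul : ∀ a b x, right (a * b) x = right b (right a x)
  left_right : ∀ a b x, left a (right b x) = right b (left a x)

namespace BanachBimodule

variable {A : Type u} {X : Type v}
  [NonUnitalNormedRing A] [NormedSpace ℂ A] [NormedAddCommGroup X] [NormedSpace ℂ X]

/-- The dual bimodule `X*`: `⟨x, a · φ⟩ = ⟨x · a, φ⟩` and `⟨x, φ · a⟩ = ⟨a · x, φ⟩`. -/
def dual (M : BanachBimodule A X) : BanachBimodule A (StrongDual ℂ X) where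
  left := (ContinuousLinearMap.compL ℂ X X ℂ).flip ∘L M.right
  right := (ContinuousLinearMap.compL ℂ X X ℂ).flip ∘L M.left
  left_mul a b φ := by ext x; simp [M.right_mul]
  right_mul a b φ := by ext x; simp [M.left_mul]
  left_right a b φ := by ext x; simp [M.left_right]

lemma dual_left_apply (M : BanachBimodule A X) (a : A) (φ : StrongDual ℂ X) (x : X) :
    M.dual.left a φ x = φ (M.right a x) := rfl

lemma dual_right_apply (M : BanachBimodule A X) (a : A) (φ : StrongDual ℂ X) (x : X) :
    M.dual.right a φ x = φ (M.left a x) := rfl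

end BanachBimodule

/-! ### The Hochschild cochain complex -/

/-- `BL n A X` is the space of bounded `n`-linear maps from `A` to `X`. -/
abbrev BL (n : ℕ) (A : Type u) (X : Type v)
    [NonUnitalNormedRing A] [NormedSpace ℂ A] [NormedAddCommGroup X] [NormedSpace ℂ X] :
    Type (max u v) :=
  ContinuousMultilinearMap ℂ (fun _ : Fin n => A) X

namespace BanachBimodule

variable {A : Type u} {X : Type v}
  [NonUnitalNormedRing A] [NormedSpace ℂ A] [NormedAddCommGroup X] [NormedSpace ℂ X]

lemma continuous_contractNth {A : Type u} [NonUnitalNormedRing A] {n : ℕ} (j : Fin n) :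
    Continuous fun a : Fin (n + 1) → A => Fin.contractNth j.castSucc (· * ·) a := by
  refine continuous_pi fun k => ?_
  unfold Fin.contractNth
  split_ifs <;> fun_prop

/-- The value `(δⁿT)(a₁, …, aₙ₊₁) = a₁ · T(a₂, …, aₙ₊₁)
  + ∑_{k=1}^{n} (-1)^k T(a₁, …, aₖaₖ₊₁, …, aₙ₊₁) + (-1)^{n+1} T(a₁, …, aₙ) · aₙ₊₁`;
`Fin.contractNth j (· * ·) a` multiplies the entries of `a` in the (zero-based) places
`j` and `j + 1`. -/
def coboundaryFun (M : BanachBimodule A X) {n : ℕ} (T : BL n A X) (a : Fin (n + 1) → A) : X :=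
  M.left (a 0) (T (Fin.tail a))
    + ∑ j : Fin n, (-1 : ℂ) ^ ((j : ℕ) + 1) • T (Fin.contractNth j.castSucc (· * ·) a)
    + (-1 : ℂ) ^ (n + 1) • M.right (a (Fin.last n)) (T (Fin.init a))

variable [IsScalarTower ℂ A A] [SMulCommClass ℂ A A]

/-- As a function of one entry of `a`, the tuple contracted at `j` changes in one entry only,
and linearly. -/
lemma contractNth_update {n : ℕ} (j : Fin n) (a : Fin (n + 1) → A) (i : Fin (n + 1)) :
    ∃ (i' : Fin n) (L : A →ₗ[ℂ] A), ∀ x,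
      Fin.contractNth j.castSucc (· * ·) (Function.update a i x) =
        Function.update (Fin.contractNth j.castSucc (· * ·) a) i' (L x) := by
  rcases lt_trichotomy (i : ℕ) j with h | h | h
  · refine ⟨⟨i, by omega⟩, LinearMap.id, fun x => ?_⟩
    ext1 k
    simp only [Fin.contractNth, Function.update_apply, Fin.ext_iff, Fin.val_castSucc,
      Fin.val_succ, LinearMap.id_apply]
    grind
  · refine ⟨j, LinearMap.mulRight ℂ (a j.succ), fun x => ?_⟩
    ext1 k
    simp only [Fin.contractNth, Function.update_apply, Fin.ext_iff, Fin.val_castSucc,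
      Fin.val_succ, LinearMap.mulRight_apply]
    grind
  · by_cases h' : (i : ℕ) = j + 1
    · refine ⟨j, LinearMap.mulLeft ℂ (a j.castSucc), fun x => ?_⟩
      ext1 k
      simp only [Fin.contractNth, Function.update_apply, Fin.ext_iff, Fin.val_castSucc,
        Fin.val_succ, LinearMap.mulLeft_apply]
      grind
    · refine ⟨⟨i - 1, by omega⟩, LinearMap.id, fun x => ?_⟩
      ext1 k
      simp only [Fin.contractNth, Function.update_apply, Fin.ext_iff, Fin.val_castSucc,
        Fin.val_succ, LinearMap.id_apply]
      grind

lemma coboundaryFun_update (M : BanachBimodule A X) {n : ℕ} (T : BL n A X)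
    (a : Fin (n + 1) → A) (i : Fin (n + 1)) :
    ∃ L : A →ₗ[ℂ] X, ∀ x, M.coboundaryFun T (Function.update a i x) = L x := by
  have h1 : ∃ L : A →ₗ[ℂ] X, ∀ x,
      M.left (Function.update a i x 0) (T (Fin.tail (Function.update a i x))) = L x := by
    refine Fin.cases ?_ (fun i => ?_) i
    · exact ⟨((M.left.flip (T (Fin.tail a))) : A →ₗ[ℂ] X), fun x => by
        simp [Fin.tail_update_zero]⟩
    · exact ⟨(M.left (a 0) : X →ₗ[ℂ] X) ∘ₗ T.toMultilinearMap.toLinearMap (Fin.tail a) i,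
        fun x => by simp [Fin.tail_update_succ, Function.update_of_ne (Fin.succ_ne_zero i).symm]⟩
  have h2 : ∀ j : Fin n, ∃ L : A →ₗ[ℂ] X, ∀ x,
      T (Fin.contractNth j.castSucc (· * ·) (Function.update a i x)) = L x := by
    intro j
    obtain ⟨i', L, hL⟩ := contractNth_update j a i
    exact ⟨T.toMultilinearMap.toLinearMap (Fin.contractNth j.castSucc (· * ·) a) i' ∘ₗ L,
      fun x => by simp [hL]⟩
  have h3 : ∃ L : A →ₗ[ℂ] X, ∀ x,
      M.right (Function.update a i x (Fin.last n)) (T (Fin.init (Function.update a i x))) =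
        L x := by
    refine Fin.lastCases ?_ (fun i => ?_) i
    · exact ⟨((M.right.flip (T (Fin.init a))) : A →ₗ[ℂ] X), fun x => by
        simp [Fin.init_update_last]⟩
    · exact ⟨(M.right (a (Fin.last n)) : X →ₗ[ℂ] X) ∘ₗ
          T.toMultilinearMap.toLinearMap (Fin.init a) i,
        fun x => by
          simp [Fin.init_update_castSucc, Function.update_of_ne (Fin.castSucc_ne_last i).symm]⟩
  obtain ⟨L1, h1⟩ := h1
  choose L2 h2 using h2
  obtain ⟨L3, h3⟩ := h3
  refine ⟨L1 + ∑ j : Fin n, (-1 : ℂ) ^ ((j : ℕ) + 1) • L2 j + (-1 : ℂ) ^ (n + 1) • L3,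
    fun x => ?_⟩
  simp [coboundaryFun, h1, h2, h3]

/-- The Hochschild coboundary operator `δⁿ : BLⁿ(A, X) → BLⁿ⁺¹(A, X)`. -/
def coboundary (M : BanachBimodule A X) (n : ℕ) : BL n A X →ₗ[ℂ] BL (n + 1) A X where
  toFun T :=
    { toFun := M.coboundaryFun T
      map_update_add' := fun {inst} a i x y => by
        obtain rfl : inst = instDecidableEqFin (n + 1) := Subsingleton.elim _ _
        obtain ⟨L, hL⟩ := M.coboundaryFun_update T a i
        simp only [hL, map_add]
      map_update_smul' := fun {inst} a i c x => by
        obtain rfl : inst = instDecidableEqFin (n + 1) := Subsingleton.elim _ _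
        obtain ⟨L, hL⟩ := M.coboundaryFun_update T a i
        simp only [hL, map_smul]
      cont := by
        have h1 : Continuous fun a : Fin (n + 1) → A => T (Fin.tail a) :=
          T.cont.comp (continuous_pi fun k => continuous_apply _)
        have h2 : Continuous fun a : Fin (n + 1) → A => T (Fin.init a) :=
          T.cont.comp (continuous_pi fun k => continuous_apply _)
        have h3 : ∀ j : Fin n, Continuous fun a : Fin (n + 1) → A =>
            T (Fin.contractNth j.castSucc (· * ·) a) :=
          fun j => T.cont.comp (continuous_contractNth j)
        change Continuous fun a => M.coboundaryFun T a
        unfold coboundaryFun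
        have h4 : Continuous fun a : Fin (n + 1) → A => M.left (a 0) (T (Fin.tail a)) :=
          (M.left.continuous.comp (continuous_apply 0)).clm_apply h1
        have h5 : Continuous fun a : Fin (n + 1) → A =>
            M.right (a (Fin.last n)) (T (Fin.init a)) :=
          (M.right.continuous.comp (continuous_apply (Fin.last n))).clm_apply h2
        exact (h4.add (continuous_finsetSum _ fun j _ => (h3 j).const_smul _)).add
          (h5.const_smul _) }
  map_add' S T := by
    ext a
    change M.coboundaryFun (S + T) a = M.coboundaryFun S a + M.coboundaryFun T a
    simp only [coboundaryFun, add_apply, map_add, smul_add,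
      Finset.sum_add_distrib]
    abel
  map_smul' c T := by
    ext a
    change M.coboundaryFun (c • T) a = c • M.coboundaryFun T a
    simp only [coboundaryFun, smul_apply, map_smul, smul_add,
      Finset.smul_sum, smul_comm c]

lemma coboundary_apply (M : BanachBimodule A X) {n : ℕ} (T : BL n A X) (a : Fin (n + 1) → A) :
    M.coboundary n T a = M.left (a 0) (T (Fin.tail a))
      + ∑ j : Fin n, (-1 : ℂ) ^ ((j : ℕ) + 1) • T (Fin.contractNth j.castSucc (· * ·) a)
      + (-1 : ℂ) ^ (n + 1) • M.right (a (Fin.last n)) (T (Fin.init a)) := rfl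

/-- The `n`-cocycles `Zⁿ(A, X) = ker δⁿ`. -/
def cocycles (M : BanachBimodule A X) (n : ℕ) : Submodule ℂ (BL n A X) :=
  LinearMap.ker (M.coboundary n)

/-- The `n`-coboundaries `Bⁿ(A, X) = ran δⁿ⁻¹` (and `B⁰ = 0`). -/
def coboundaries (M : BanachBimodule A X) : (n : ℕ) → Submodule ℂ (BL n A X)
  | 0 => ⊥
  | n + 1 => LinearMap.range (M.coboundary n)

end BanachBimodule

/-! ### Approximate Hochschild cohomology -/

section Approximate

variable {A : Type u} {X : Type v}
  [NonUnitalNormedRing A] [NormedSpace ℂ A] [NormedAddCommGroup X] [NormedSpace ℂ X]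

/-- The strong topology on `BLⁿ(A, X)`: a net `T_i` converges to `T` iff
`‖(T_i - T)(a₁, …, aₙ)‖ → 0` for all `a₁, …, aₙ ∈ A`. -/
abbrev strongTopology (n : ℕ) (A : Type u) (X : Type v)
    [NonUnitalNormedRing A] [NormedSpace ℂ A] [NormedAddCommGroup X] [NormedSpace ℂ X] :
    TopologicalSpace (BL n A X) :=
  TopologicalSpace.induced (fun T : BL n A X => (T : (Fin n → A) → X)) Pi.topologicalSpace

/-- The closure of a subspace of `BLⁿ(A, X)` in the strong topology. -/
def strongClosure {n : ℕ} (S : Submodule ℂ (BL n A X)) : Submodule ℂ (BL n A X) :=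
  letI : TopologicalSpace (BL n A X) := strongTopology n A X
  let ev : BL n A X →ₗ[ℂ] ((Fin n → A) → X) :=
    { toFun := fun T => T, map_add' := fun _ _ => rfl, map_smul' := fun _ _ => rfl }
  have key : closure (S : Set (BL n A X)) = ev ⁻¹' ((S.map ev).topologicalClosure : Set _) := by
    ext T
    exact closure_induced (f := fun T : BL n A X => (T : (Fin n → A) → X))
  { carrier := closure (S : Set (BL n A X))
    add_mem' := fun {a b} ha hb => by
      rw [key] at ha hb ⊢
      exact ((S.map ev).topologicalClosure.comap ev).add_mem ha hb
    zero_mem' := subset_closure S.zero_mem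
    smul_mem' := fun c {a} ha => by
      rw [key] at ha ⊢
      exact ((S.map ev).topologicalClosure.comap ev).smul_mem c ha }

lemma coe_strongClosure {n : ℕ} (S : Submodule ℂ (BL n A X)) :
    (strongClosure S : Set (BL n A X)) = closure[strongTopology n A X] (S : Set (BL n A X)) :=
  rfl

/-- The `n`-th approximate Hochschild cohomology: the quotient of `Zⁿ(A, X)` by the strong
closure of `Bⁿ(A, X)`. -/
abbrev HApp [IsScalarTower ℂ A A] [SMulCommClass ℂ A A] (n : ℕ) (M : BanachBimodule A X) :
    Type (max u v) :=
  M.cocycles n ⧸ (strongClosure (M.coboundaries n)).submoduleOf (M.cocycles n)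

end Approximate

end

noncomputable section

set_option maxSynthPendingDepth 3

/-! ### Point masses and the universal property of `ℓ¹` -/

namespace L1

section Basis

variable {S : Type u} {V : Type v} [NormedAddCommGroup V] [NormedSpace ℂ V]

/-! A 2-cocycle `T` of ℓ¹(H) in X* is coinduced to ℓ¹(G), where the hypothesis applies, and the
result is read back on H. Let E be the space of bounded bilinear maps F : ℓ¹(G) × ℓ¹(G) → X* that
are equivariant under left multiplication by ℓ¹(H) in the first variable and under right
multiplication in the second (`coind`). It is an ℓ¹(G)-bimodule by translation on the inner sides,
and evaluation at (1, 1) is an ℓ¹(H)-bimodule map p : E → X*.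

Let r : G → H be a retraction equivariant for left translation by H. For point masses put K(x, y)(a,
b) = r(a) · T(r(a)⁻¹ r(ax), r(ax)⁻¹ r(axy)) · r(axy)⁻¹ w if w = axyb lies in H, and 0 otherwise.
These values are bounded, so K extends to ℓ¹(G) (`lift₄`). It takes values in E
(`extendFun_mul_left`, `extendFun_mul_right`) and is a 2-cocycle (`extendFun_cocycle`); at a = b = 1
its restriction to H is 1 · T · 1 (`extend_incl`).

E need not be a dual bimodule, so K is viewed in E**, where it is a strong limit of coboundaries.
The map p extends to a bimodule map E** → X*; composing with it and restricting to ℓ¹(H) preserves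
strong limits of coboundaries (`comp_mem_strongClosure_of_mem_cocycles`). Hence 1 · T · 1 is such a
limit. The actions need not be unital, but T differs from 1 · T · 1 by a coboundary
(`sub_unit_compression_mem_coboundaries`). -/

open Classical in
/-- The point mass at `s`. -/
def delta (s : S) : L1 S := lp.single 1 s (1 : ℂ)

open Classical in
lemma delta_apply (s t : S) : delta s t = if t = s then 1 else 0 := by
  simp [delta, Pi.single_apply]

lemma norm_delta (s : S) : ‖delta s‖ = 1 := by
  simp [delta, lp.norm_single]

lemma hasSum_smul_delta (a : L1 S) : HasSum (fun s => a s • delta s) a := by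
  classical
  convert lp.hasSum_single ENNReal.one_ne_top a with s
  rw [delta, ← lp.single_smul, smul_eq_mul, mul_one]

/-- Two continuous linear functions on `ℓ¹(S)` that agree on the point masses are equal. -/
lemma eq_of_delta {f g : L1 S → V} (hf : IsLinearMap ℂ f ∧ Continuous f)
    (hg : IsLinearMap ℂ g ∧ Continuous g) (h : ∀ s, f (delta s) = g (delta s)) (a : L1 S) :
    f a = g a := by
  have h1 := (hasSum_smul_delta a).map hf.1.mk' hf.2
  have h2 := (hasSum_smul_delta a).map hg.1.mk' hg.2
  have h3 : hf.1.mk' ∘ (fun s => a s • delta s) = hg.1.mk' ∘ fun s => a s • delta s := by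
    ext s
    simp [h]
  rw [h3] at h1
  exact h1.unique h2

lemma summable_norm_smul {f : S → V} {C : ℝ} (hf : ∀ s, ‖f s‖ ≤ C) (a : L1 S) :
    Summable fun s => ‖a s • f s‖ := by
  refine Summable.of_nonneg_of_le (fun _ => norm_nonneg _) (fun s => ?_)
    (a.summable_norm.mul_right C)
  rw [norm_smul]
  exact mul_le_mul_of_nonneg_left (hf s) (norm_nonneg _)

variable [CompleteSpace V]

/-- The bounded linear extension to `ℓ¹(S)` of a bounded function on `S`. -/
def lift (f : S → V) (C : ℝ) (hf : ∀ s, ‖f s‖ ≤ C) : L1 S →L[ℂ] V :=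
  LinearMap.mkContinuous
    { toFun := fun a => ∑' s, a s • f s
      map_add' := fun a b => by
        simp only [lp.coeFn_add, Pi.add_apply, add_smul]
        exact (summable_norm_smul hf a).of_norm.tsum_add (summable_norm_smul hf b).of_norm
      map_smul' := fun c a => by
        simp only [lp.coeFn_smul, Pi.smul_apply, smul_assoc, RingHom.id_apply]
        exact (summable_norm_smul hf a).of_norm.tsum_const_smul c } C fun a => by
    refine (norm_tsum_le_tsum_norm (summable_norm_smul hf a)).trans ?_
    rw [mul_comm, norm_eq, ← tsum_mul_right]
    refine (summable_norm_smul hf a).tsum_le_tsum (fun s => ?_) (a.summable_norm.mul_right C)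
    rw [norm_smul]
    exact mul_le_mul_of_nonneg_left (hf s) (norm_nonneg _)

lemma lift_apply (f : S → V) (C : ℝ) (hf : ∀ s, ‖f s‖ ≤ C) (a : L1 S) :
    lift f C hf a = ∑' s, a s • f s := rfl

lemma lift_delta (f : S → V) (C : ℝ) (hf : ∀ s, ‖f s‖ ≤ C) (s : S) :
    lift f C hf (delta s) = f s := by
  rw [lift_apply, tsum_eq_single s]
  · simp [delta_apply]
  · intro t ht
    simp [delta_apply, ht]

lemma norm_lift_le (f : S → V) (C : ℝ) (hC : 0 ≤ C) (hf : ∀ s, ‖f s‖ ≤ C) :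
    ‖lift f C hf‖ ≤ C :=
  LinearMap.mkContinuous_norm_le _ hC _

/-- The bounded `4`-linear extension to `ℓ¹(S)` of a bounded function of four variables. -/
def lift₄ (Φ : S → S → S → S → V) (C : ℝ) (hC : 0 ≤ C) (hΦ : ∀ x y z w, ‖Φ x y z w‖ ≤ C) :
    L1 S →L[ℂ] L1 S →L[ℂ] L1 S →L[ℂ] L1 S →L[ℂ] V :=
  lift (fun x => lift (fun y => lift (fun z => lift (Φ x y z) C (hΦ x y z)) C
    fun _ => norm_lift_le _ C hC _) C fun _ => norm_lift_le _ C hC _) C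
    fun _ => norm_lift_le _ C hC _

lemma lift₄_delta (Φ : S → S → S → S → V) (C : ℝ) (hC : 0 ≤ C)
    (hΦ : ∀ x y z w, ‖Φ x y z w‖ ≤ C) (x y z w : S) :
    lift₄ Φ C hC hΦ (delta x) (delta y) (delta z) (delta w) = Φ x y z w := by
  simp only [lift₄, lift_delta]

end Basis

/-! ### Products of point masses and the inclusion of ℓ¹(H) in ℓ¹(G). -/

variable {G : Type u} [Group G]

lemma delta_mul_delta (g h : G) : delta g * delta h = delta (g * h) := by
  ext x
  rw [mul_apply, tsum_eq_single g]
  · by_cases hx : x = g * h <;> simp [delta_apply, inv_mul_eq_iff_eq_mul, hx]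
  · intro y hy
    simp [delta_apply, hy]

lemma one_mul_delta (a : L1 G) : delta 1 * a = a := by
  ext x
  rw [mul_apply, tsum_eq_single 1]
  · simp [delta_apply]
  · intro y hy
    simp [delta_apply, hy]

lemma mul_one_delta (a : L1 G) : a * delta 1 = a := by
  ext x
  rw [mul_apply, tsum_eq_single x]
  · simp [delta_apply]
  · intro y hy
    simp [delta_apply, inv_mul_eq_one, hy]

/-- The inclusion `ℓ¹(H) → ℓ¹(G)` for a subgroup `H` of `G`. -/
def incl (H : Subgroup G) : L1 H →L[ℂ] L1 G :=
  lift (fun h : H => delta (h : G)) 1 fun h => (norm_delta (h : G)).le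

lemma incl_delta (H : Subgroup G) (h : H) : incl H (delta h) = delta (h : G) :=
  lift_delta _ _ _ h

lemma incl_mul (H : Subgroup G) (a b : L1 H) : incl H (a * b) = incl H a * incl H b := by
  refine eq_of_delta (f := fun a => incl H (a * b)) (g := fun a => incl H a * incl H b)
    ⟨⟨by simp [add_mul], fun c x => by simp [smul_mul_assoc]⟩, by fun_prop⟩ ⟨⟨by simp [add_mul], fun c x => by simp [smul_mul_assoc]⟩,
    by fun_prop⟩ (fun g => ?_) a
  refine eq_of_delta (f := fun b => incl H (delta g * b))
    (g := fun b => incl H (delta g) * incl H b)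
    ⟨⟨by simp [mul_add], fun c x => by simp [mul_smul_comm]⟩, by fun_prop⟩ ⟨⟨by simp [mul_add], fun c x => by simp [mul_smul_comm]⟩,
    by fun_prop⟩ (fun h => ?_) b
  simp [delta_mul_delta, incl_delta]

end L1

/-- A retraction `r : G → H` that is equivariant for left translation by `H`. -/
lemma Subgroup.exists_equivariant_retraction {G : Type u} [Group G] (H : Subgroup G) :
    ∃ r : G → H, (∀ (h : H) g, r (h * g) = h * r g) ∧ ∀ h : H, r h = h := by
  -- The retraction sends g = ht to h. The transversal is chosen to contain 1, which forces r(1) =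
  -- 1.
  obtain ⟨T, hT, h1⟩ := H.exists_isComplement_right 1
  have hmul : ∀ (h : H) (g : G), (hT.equiv (h * g)).fst = h * (hT.equiv g).fst := fun h g => by
    rw [hT.equiv_mul_left h g]
  refine ⟨fun g => (hT.equiv g).fst, hmul, fun h => ?_⟩
  have := hmul h 1
  rw [mul_one, hT.equiv_fst_eq_one_of_mem_of_one_mem H.one_mem h1] at this
  exact this.trans (mul_one h)

/-! ### Low-degree cochains -/

namespace BanachBimodule

section Approx
variable {A : Type u} {X : Type v}
  [NonUnitalNormedRing A] [NormedSpace ℂ A] [NormedAddCommGroup X] [NormedSpace ℂ X]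
  [IsScalarTower ℂ A A] [SMulCommClass ℂ A A]

lemma subsingleton_HApp_iff (M : BanachBimodule A X) (n : ℕ) :
    Subsingleton (HApp n M) ↔ M.cocycles n ≤ strongClosure (M.coboundaries n) := by
  rw [Submodule.Quotient.subsingleton_iff, Submodule.submoduleOf_eq_top]

lemma coboundaries_le_strongClosure (M : BanachBimodule A X) (n : ℕ) :
    M.coboundaries n ≤ strongClosure (M.coboundaries n) := fun T hT => by
  rw [← SetLike.mem_coe, coe_strongClosure]
  exact @subset_closure _ (strongTopology n A X) _ _ hT

lemma coboundary_one_apply (M : BanachBimodule A X) (S : BL 1 A X) (a : Fin 2 → A) :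
    M.coboundary 1 S a = M.left (a 0) (S ![a 1]) - S ![a 0 * a 1] + M.right (a 1) (S ![a 0]) := by
  have h1 : Fin.tail a = ![a 1] := by ext i; fin_cases i; rfl
  have h2 : Fin.init a = ![a 0] := by ext i; fin_cases i; rfl
  have h3 : Fin.contractNth (0 : Fin 1).castSucc (· * ·) a = ![a 0 * a 1] := by
    ext i; fin_cases i; rfl
  rw [coboundary_apply, Fin.sum_univ_one, h1, h2, h3]
  simp [sub_eq_add_neg]

lemma coboundary_two_apply (M : BanachBimodule A X) (T : BL 2 A X) (a : Fin 3 → A) :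
    M.coboundary 2 T a = M.left (a 0) (T ![a 1, a 2]) - T ![a 0 * a 1, a 2]
      + T ![a 0, a 1 * a 2] - M.right (a 2) (T ![a 0, a 1]) := by
  have h1 : Fin.tail a = ![a 1, a 2] := by ext i; fin_cases i <;> rfl
  have h2 : Fin.init a = ![a 0, a 1] := by ext i; fin_cases i <;> rfl
  have h3 : Fin.contractNth (0 : Fin 2).castSucc (· * ·) a = ![a 0 * a 1, a 2] := by
    ext i; fin_cases i <;> rfl
  have h4 : Fin.contractNth (1 : Fin 2).castSucc (· * ·) a = ![a 0, a 1 * a 2] := by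
    ext i; fin_cases i <;> rfl
  rw [coboundary_apply, Fin.sum_univ_two, h1, h2, h3, h4]
  simp [sub_eq_add_neg, pow_succ, add_assoc]

lemma mem_cocycles_two_iff (M : BanachBimodule A X) (T : BL 2 A X) :
    T ∈ M.cocycles 2 ↔ ∀ a b c, M.left a (T ![b, c]) - T ![a * b, c] + T ![a, b * c]
      - M.right c (T ![a, b]) = 0 := by
  rw [cocycles, LinearMap.mem_ker, ContinuousMultilinearMap.ext_iff]
  simp only [coboundary_two_apply, zero_apply]
  exact ⟨fun h a b c => h ![a, b, c], fun h a => h _ _ _⟩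

/-- Over an algebra with unit `e`, a `2`-cocycle `T` is cohomologous to `e · T · e`. -/
lemma sub_unit_compression_mem_coboundaries (M : BanachBimodule A X) {e : A}
    (he : ∀ a, e * a = a) (he' : ∀ a, a * e = a) {T : BL 2 A X} (hT : T ∈ M.cocycles 2) :
    T - (M.left e ∘L M.right e).compContinuousMultilinearMap T ∈ M.coboundaries 2 := by
  rw [mem_cocycles_two_iff] at hT
  -- T - e·T·e = P T + e·(Q T). Since `A` acts by zero from the left on the range of `P` and from
  -- the right on that of `Q`, the cocycle identities at (e, a, b) and (a, b, e) exhibit the two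
  -- summands as coboundaries.
  let P : X →L[ℂ] X := ContinuousLinearMap.id ℂ X - M.left e
  let Q : X →L[ℂ] X := ContinuousLinearMap.id ℂ X - M.right e
  let L : A →L[ℂ] X := -(P ∘L T.toContinuousLinearMap ![e, 0] 1
    + (M.left e ∘L Q) ∘L T.toContinuousLinearMap ![0, e] 0)
  let S : BL 1 A X := ContinuousMultilinearMap.ofSubsingleton ℂ A X (0 : Fin 1) L
  have hu1 : ∀ x : A, Function.update ![e, 0] 1 x = ![e, x] := fun x => by
    ext i; fin_cases i <;> rfl
  have hu2 : ∀ x : A, Function.update ![0, e] 0 x = ![x, e] := fun x => by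
    ext i; fin_cases i <;> rfl
  have hS : ∀ x, S ![x] = -((T ![e, x] - M.left e (T ![e, x]))
      + M.left e (T ![x, e] - M.right e (T ![x, e]))) := fun x => by
    simp [S, L, P, Q, hu1, hu2]
  refine ⟨S, ?_⟩
  ext m
  obtain ⟨a, b, rfl⟩ : ∃ a b, m = ![a, b] := ⟨m 0, m 1, by ext i; fin_cases i <;> rfl⟩
  have hl : ∀ x, M.left a (M.left e x) = M.left a x := fun x => by rw [← M.left_mul, he']
  have hl' : ∀ x, M.left e (M.left a x) = M.left a x := fun x => by rw [← M.left_mul, he]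
  have hr : ∀ x, M.right b (M.right e x) = M.right b x := fun x => by rw [← M.right_mul, he]
  have h1 := hT e a b
  have h2 := congrArg (M.left e) (hT a b e)
  have h3 := congrArg (M.left e) (hT e a b)
  have h4 := congrArg (fun x => M.left e (M.right e x)) (hT a b e)
  have hll : ∀ x, M.left e (M.left e x) = M.left e x := fun x => by rw [← M.left_mul, he]
  have hrr : ∀ x, M.right e (M.right e x) = M.right e x := fun x => by rw [← M.right_mul, he]
  simp only [he, he', map_add, map_sub, map_zero, ← M.left_right, hl', hll, hrr]
    at h1 h2 h3 h4
  rw [coboundary_one_apply]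
  simp [hS, hl, hr, ← M.left_right]
  -- `h1 - h3` is `P` applied to the identity at (e, a, b); `h2 - h4` is `e · Q` applied to the
  -- identity at (a, b, e).
  linear_combination (norm := module) h1 - h3 - (h2 - h4)

end Approx

end BanachBimodule

/-! ### The coinduced bimodule -/

namespace BanachBimodule

section Coinduced

variable {A B : Type u} {V : Type v} [NonUnitalNormedRing A] [NormedSpace ℂ A]
  [NonUnitalNormedRing B] [NormedSpace ℂ B] [NormedAddCommGroup V] [NormedSpace ℂ V]

/-- The bounded bilinear maps `F : A × A → V` that satisfy
`F(ι h * a, b) = h · F(a, b)` and `F(a, b * ι h) = F(a, b) · h` for `h ∈ B`. -/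
def coind (N : BanachBimodule B V) (ι : B →L[ℂ] A) : Submodule ℂ (A →L[ℂ] A →L[ℂ] V) where
  carrier := {F | ∀ h a b, F (ι h * a) b = N.left h (F a b) ∧ F a (b * ι h) = N.right h (F a b)}
  add_mem' hF hF' h a b := by
    simp [(hF h a b).1, (hF h a b).2, (hF' h a b).1, (hF' h a b).2]
  zero_mem' h a b := by simp
  smul_mem' c F hF h a b := by simp [(hF h a b).1, (hF h a b).2]

/-- Evaluation at `(e, e)` on the coinduced space. -/
def coindEval (N : BanachBimodule B V) (ι : B →L[ℂ] A) (e : A) : N.coind ι →L[ℂ] V :=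
  (ContinuousLinearMap.apply ℂ V e ∘L ContinuousLinearMap.apply ℂ (A →L[ℂ] V) e) ∘L
    (N.coind ι).subtypeL

lemma coindEval_apply (N : BanachBimodule B V) (ι : B →L[ℂ] A) (e : A) (F : N.coind ι) :
    N.coindEval ι e F = F.1 e e := rfl

variable [IsScalarTower ℂ A A] [SMulCommClass ℂ A A]

/-- The left action `(x · F)(a, b) = F(a * x, b)` on the coinduced space. -/
def coindLeft (N : BanachBimodule B V) (ι : B →L[ℂ] A) :
    A →L[ℂ] N.coind ι →L[ℂ] N.coind ι :=
  LinearMap.mkContinuous₂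
    (LinearMap.mk₂ ℂ (fun (x : A) (F : N.coind ι) =>
      (⟨F.1 ∘L (ContinuousLinearMap.mul ℂ A).flip x, fun h a b => by
        simpa [mul_assoc] using F.2 h (a * x) b⟩ : N.coind ι))
      (fun x y F => by ext a b; simp)
      (fun c x F => by ext a b; simp)
      (fun x F F' => by ext a b; simp)
      (fun c x F => by ext a b; simp)) 1 fun x F => by
    refine ContinuousLinearMap.opNorm_le_bound₂ _ (by positivity) fun a b => ?_
    change ‖F.1 (a * x) b‖ ≤ _
    calc ‖F.1 (a * x) b‖ ≤ ‖F‖ * ‖a * x‖ * ‖b‖ := F.1.le_opNorm₂ (a * x) b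
      _ ≤ ‖F‖ * (‖a‖ * ‖x‖) * ‖b‖ := by gcongr; exact norm_mul_le a x
      _ = 1 * ‖x‖ * ‖F‖ * ‖a‖ * ‖b‖ := by ring

/-- The right action `(F · y)(a, b) = F(a, y * b)` on the coinduced space. -/
def coindRight (N : BanachBimodule B V) (ι : B →L[ℂ] A) :
    A →L[ℂ] N.coind ι →L[ℂ] N.coind ι :=
  LinearMap.mkContinuous₂
    (LinearMap.mk₂ ℂ (fun (y : A) (F : N.coind ι) =>
      (⟨(ContinuousLinearMap.compL ℂ A A V).flip (ContinuousLinearMap.mul ℂ A y) ∘L F.1,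
        fun h a b => by simpa [mul_assoc] using F.2 h a (y * b)⟩ : N.coind ι))
      (fun x y F => by ext a b; simp)
      (fun c x F => by ext a b; simp)
      (fun x F F' => by ext a b; simp)
      (fun c x F => by ext a b; simp)) 1 fun y F => by
    refine ContinuousLinearMap.opNorm_le_bound₂ _ (by positivity) fun a b => ?_
    change ‖F.1 a (y * b)‖ ≤ _
    calc ‖F.1 a (y * b)‖ ≤ ‖F‖ * ‖a‖ * ‖y * b‖ := F.1.le_opNorm₂ a (y * b)
      _ ≤ ‖F‖ * ‖a‖ * (‖y‖ * ‖b‖) := by gcongr; exact norm_mul_le y b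
      _ = 1 * ‖y‖ * ‖F‖ * ‖a‖ * ‖b‖ := by ring

lemma coindLeft_apply (N : BanachBimodule B V) (ι : B →L[ℂ] A) (x : A)
    (F : N.coind ι) (a b : A) : (N.coindLeft ι x F).1 a b = F.1 (a * x) b := rfl

lemma coindRight_apply (N : BanachBimodule B V) (ι : B →L[ℂ] A) (y : A)
    (F : N.coind ι) (a b : A) : (N.coindRight ι y F).1 a b = F.1 a (y * b) := rfl

/-- The coinduced `A`-bimodule. -/
def coindBimodule (N : BanachBimodule B V) (ι : B →L[ℂ] A) :
    BanachBimodule A (N.coind ι) where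
  left := N.coindLeft ι
  right := N.coindRight ι
  left_mul x y F := by ext a b; simp only [coindLeft_apply, mul_assoc]
  right_mul x y F := by ext a b; simp only [coindRight_apply, mul_assoc]
  left_right x y F := by ext a b; simp only [coindLeft_apply, coindRight_apply]

/-- Because e commutes with ι b, the inner translation F(e * ι b, e) is also the outer one F(ι b *
e, e), to which equivariance applies. -/
lemma coindEval_left (N : BanachBimodule B V) (ι : B →L[ℂ] A) {e : A} (he : ∀ a, e * a = a)
    (he' : ∀ a, a * e = a) (b : B) (F : N.coind ι) :
    N.coindEval ι e ((N.coindBimodule ι).left (ι b) F) = N.left b (N.coindEval ι e F) := by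
  rw [coindEval_apply, coindEval_apply, ← (F.2 b e e).1, he']
  exact congrArg (fun a => F.1 a e) (he (ι b))

lemma coindEval_right (N : BanachBimodule B V) (ι : B →L[ℂ] A) {e : A} (he : ∀ a, e * a = a)
    (he' : ∀ a, a * e = a) (b : B) (F : N.coind ι) :
    N.coindEval ι e ((N.coindBimodule ι).right (ι b) F) = N.right b (N.coindEval ι e F) := by
  rw [coindEval_apply, coindEval_apply, ← (F.2 b e e).2, he]
  exact congrArg (fun a => F.1 e a) (he' (ι b))

end Coinduced

/-! ### Transfer of approximate coboundaries from `A` to `B`, through the bidual. -/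

section Transfer

variable {A B : Type u} [NonUnitalNormedRing A] [NormedSpace ℂ A]
  [NonUnitalNormedRing B] [NormedSpace ℂ B]
  [IsScalarTower ℂ A A] [SMulCommClass ℂ A A] [IsScalarTower ℂ B B] [SMulCommClass ℂ B B]

/-- Pulling back along an algebra homomorphism `ι` and pushing forward along a bimodule map `q`
preserves the strong closure of the coboundaries. -/
lemma comp_mem_strongClosure_coboundaries {Y Z : Type*} [NormedAddCommGroup Y] [NormedSpace ℂ Y]
    [NormedAddCommGroup Z] [NormedSpace ℂ Z] (M : BanachBimodule A Y) (N : BanachBimodule B Z)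
    (ι : B →L[ℂ] A) (hι : ∀ a b, ι (a * b) = ι a * ι b) (q : Y →L[ℂ] Z)
    (hl : ∀ b y, q (M.left (ι b) y) = N.left b (q y))
    (hr : ∀ b y, q (M.right (ι b) y) = N.right b (q y))
    {T : BL 2 A Y} (hT : T ∈ strongClosure (M.coboundaries 2)) :
    (q.compContinuousMultilinearMap T).compContinuousLinearMap (fun _ => ι) ∈
      strongClosure (N.coboundaries 2) := by
  rw [← SetLike.mem_coe, coe_strongClosure] at hT ⊢
  let Ψ : BL 2 A Y → BL 2 B Z := fun T =>
    (q.compContinuousMultilinearMap T).compContinuousLinearMap (fun _ => ι)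
  have hΨ : @Continuous _ _ (strongTopology 2 A Y) (strongTopology 2 B Z) Ψ := by
    let _ := strongTopology 2 A Y
    -- The value of `Ψ T` at `m` depends on a single value of `T`, the one at ι ∘ m, so pointwise
    -- convergence is preserved.
    refine continuous_induced_rng.2 (continuous_pi fun m => ?_)
    exact q.continuous.comp ((continuous_apply (fun i => ι (m i))).comp continuous_induced_dom)
  refine @map_mem_closure _ _ (strongTopology 2 A Y) (strongTopology 2 B Z) Ψ _ _ _ hΨ hT ?_
  rintro _ ⟨S, rfl⟩
  refine ⟨(q.compContinuousMultilinearMap S).compContinuousLinearMap (fun _ => ι), ?_⟩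
  ext m
  have h1 : ∀ a : B, (fun i : Fin 1 => ι (![a] i)) = ![ι a] := fun a => by
    ext i; fin_cases i; rfl
  rw [coboundary_one_apply]
  change _ = q (M.coboundary 1 S fun i => ι (m i))
  simp only [coboundary_one_apply, ContinuousMultilinearMap.compContinuousLinearMap_apply,
    ContinuousLinearMap.compContinuousMultilinearMap_coe, Function.comp_apply, h1, hι, hl, hr,
    map_add, map_sub]

/-- If the second approximate cohomology of `A` vanishes in all dual bimodules and `p : E → X*` is
a `B`-bimodule map, then `p` carries `2`-cocycles of `A` in `E` to strong limits of coboundaries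
of `B`: embed `E` into its bidual and extend `p`. -/
lemma comp_mem_strongClosure_of_mem_cocycles
    (hA : ∀ (Y : Type (max u v)) [NormedAddCommGroup Y] [NormedSpace ℂ Y] [CompleteSpace Y]
      (M : BanachBimodule A Y), Subsingleton (HApp 2 M.dual))
    {X E : Type (max u v)} [NormedAddCommGroup X] [NormedSpace ℂ X] [NormedAddCommGroup E]
    [NormedSpace ℂ E] (M : BanachBimodule B X) (N : BanachBimodule A E)
    (ι : B →L[ℂ] A) (hι : ∀ a b, ι (a * b) = ι a * ι b) (p : E →L[ℂ] StrongDual ℂ X)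
    (hl : ∀ b f, p (N.left (ι b) f) = M.dual.left b (p f))
    (hr : ∀ b f, p (N.right (ι b) f) = M.dual.right b (p f))
    {F : BL 2 A E} (hF : F ∈ N.cocycles 2) :
    (p.compContinuousMultilinearMap F).compContinuousLinearMap (fun _ => ι) ∈
      strongClosure (M.dual.coboundaries 2) := by
  let J := NormedSpace.inclusionInDoubleDual ℂ E
  let Z : BL 2 A (StrongDual ℂ (StrongDual ℂ E)) := J.compContinuousMultilinearMap F
  have hJl : ∀ x f, N.dual.dual.left x (J f) = J (N.left x f) := fun x f => rfl
  have hJr : ∀ x f, N.dual.dual.right x (J f) = J (N.right x f) := fun x f => rfl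
  have hZ : Z ∈ N.dual.dual.cocycles 2 := by
    rw [mem_cocycles_two_iff] at hF ⊢
    intro x y z
    change N.dual.dual.left x (J (F ![y, z])) - J (F ![x * y, z]) + J (F ![x, y * z])
      - N.dual.dual.right z (J (F ![x, y])) = 0
    rw [hJl, hJr, ← map_sub, ← map_add, ← map_sub, hF, map_zero]
  -- `q` is the adjoint of the map X → E* obtained from `p` by exchanging arguments; it satisfies q
  -- ∘ J = p.
  let q : StrongDual ℂ (StrongDual ℂ E) →L[ℂ] StrongDual ℂ X :=
    (ContinuousLinearMap.compL ℂ X (StrongDual ℂ E) ℂ).flip p.flip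
  have hq : ∀ Λ x, q Λ x = Λ (p.flip x) := fun Λ x => rfl
  -- The hypothesis is applied to the bimodule E*, which is complete whether or not E is.
  refine comp_mem_strongClosure_coboundaries N.dual.dual M.dual ι hι q (fun b Λ => ?_)
    (fun b Λ => ?_) (((subsingleton_HApp_iff _ _).1 (hA _ N.dual)) hZ)
  · ext x
    rw [hq, dual_left_apply, dual_left_apply, hq]
    congr 1
    ext f
    rw [dual_right_apply, ContinuousLinearMap.flip_apply, hl, dual_left_apply,
      ContinuousLinearMap.flip_apply]
  · ext x
    rw [hq, dual_right_apply, dual_right_apply, hq]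
    congr 1
    ext f
    rw [dual_left_apply, ContinuousLinearMap.flip_apply, hr, dual_right_apply,
      ContinuousLinearMap.flip_apply]

/-- A bounded bilinear map as a bounded `2`-linear map. -/
def ofBilin {V : Type v} [NormedAddCommGroup V] [NormedSpace ℂ V] (K : A →L[ℂ] A →L[ℂ] V) :
    BL 2 A V where
  toFun m := K (m 0) (m 1)
  map_update_add' {inst} m i x y := by
    obtain rfl : inst = instDecidableEqFin 2 := Subsingleton.elim _ _
    fin_cases i <;> simp
  map_update_smul' {inst} m i c x := by
    obtain rfl : inst = instDecidableEqFin 2 := Subsingleton.elim _ _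
    fin_cases i <;> simp
  cont := by fun_prop

/-- If the second approximate cohomology of `A` vanishes in all dual bimodules, then a bounded
`2`-linear map on `B` that comes from a `2`-cocycle of `A` in the coinduced bimodule is a strong
limit of coboundaries. -/
lemma mem_strongClosure_coboundaries_of_lift
    (hA : ∀ (Y : Type (max u v)) [NormedAddCommGroup Y] [NormedSpace ℂ Y] [CompleteSpace Y]
      (M : BanachBimodule A Y), Subsingleton (HApp 2 M.dual))
    {X : Type (max u v)} [NormedAddCommGroup X] [NormedSpace ℂ X] (M : BanachBimodule B X)
    (ι : B →L[ℂ] A) (hι : ∀ a b, ι (a * b) = ι a * ι b) {e : A} (he : ∀ a, e * a = a)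
    (he' : ∀ a, a * e = a) (K : A →L[ℂ] A →L[ℂ] A →L[ℂ] A →L[ℂ] StrongDual ℂ X)
    (hl : ∀ x y h a b, K x y (ι h * a) b = M.dual.left h (K x y a b))
    (hr : ∀ x y h a b, K x y a (b * ι h) = M.dual.right h (K x y a b))
    (hK : ∀ x y z a b, K y z (a * x) b - K (x * y) z a b + K x (y * z) a b - K x y a (z * b) = 0)
    {T : BL 2 B (StrongDual ℂ X)} (hT : ∀ m, T m = K (ι (m 0)) (ι (m 1)) e e) :
    T ∈ strongClosure (M.dual.coboundaries 2) := by
  let F : BL 2 A (M.dual.coind ι) :=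
    (ofBilin K).codRestrict (M.dual.coind ι) fun m h a b => ⟨hl _ _ h a b, hr _ _ h a b⟩
  have hF : F ∈ (M.dual.coindBimodule ι).cocycles 2 := by
    rw [mem_cocycles_two_iff]
    intro x y z
    ext1
    ext1 a
    ext1 b
    exact hK x y z a b
  have hmem := comp_mem_strongClosure_of_mem_cocycles hA M (M.dual.coindBimodule ι) ι hι
    (M.dual.coindEval ι e) (M.dual.coindEval_left ι he he') (M.dual.coindEval_right ι he he') hF
  convert hmem
  ext1 m
  exact hT m

end Transfer

end BanachBimodule

/-! ### Extension of cocycles from a subgroup -/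

namespace L1

variable {G : Type u} [Group G] {V : Type v} [NormedAddCommGroup V] [NormedSpace ℂ V]

/-- An equivariance relation in the third variable holds if it holds for point masses. -/
lemma equivariant_left_of_delta {H : Subgroup G}
    (K : L1 G →L[ℂ] L1 G →L[ℂ] L1 G →L[ℂ] L1 G →L[ℂ] V) (l : L1 H →L[ℂ] V →L[ℂ] V)
    (h : ∀ (x y : G) (k : H) (a b : G), K (delta x) (delta y) (delta (k * a)) (delta b) =
      l (delta k) (K (delta x) (delta y) (delta a) (delta b)))
    (x y : L1 G) (k : L1 H) (a b : L1 G) :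
    K x y (incl H k * a) b = l k (K x y a b) := by
  -- Both sides are linear and continuous in each variable, so the variables are replaced by point
  -- masses one at a time.
  refine eq_of_delta (f := fun x => K x y (incl H k * a) b)
    (g := fun x => l k (K x y a b))
    ⟨⟨by simp, fun c x => by simp⟩, by fun_prop⟩ ⟨⟨by simp, fun c x => by simp⟩, by fun_prop⟩
    (fun x => ?_) x
  refine eq_of_delta (f := fun y => K (delta x) y (incl H k * a) b)
    (g := fun y => l k (K (delta x) y a b))
    ⟨⟨by simp, fun c x => by simp⟩, by fun_prop⟩ ⟨⟨by simp, fun c x => by simp⟩, by fun_prop⟩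
    (fun y => ?_) y
  refine eq_of_delta (f := fun k => K (delta x) (delta y) (incl H k * a) b)
    (g := fun k => l k (K (delta x) (delta y) a b))
    ⟨⟨by simp [add_mul], fun c x => by simp [smul_mul_assoc]⟩, by fun_prop⟩
    ⟨⟨by simp, fun c x => by simp⟩, by fun_prop⟩ (fun k => ?_) k
  refine eq_of_delta (f := fun a => K (delta x) (delta y) (incl H (delta k) * a) b)
    (g := fun a => l (delta k) (K (delta x) (delta y) a b))
    ⟨⟨by simp [mul_add], fun c x => by simp [mul_smul_comm]⟩, by fun_prop⟩
    ⟨⟨by simp, fun c x => by simp⟩, by fun_prop⟩ (fun a => ?_) a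
  refine eq_of_delta (f := fun b => K (delta x) (delta y) (incl H (delta k) * delta a) b)
    (g := fun b => l (delta k) (K (delta x) (delta y) (delta a) b))
    ⟨⟨by simp, fun c x => by simp⟩, by fun_prop⟩ ⟨⟨by simp, fun c x => by simp⟩, by fun_prop⟩
    (fun b => ?_) b
  simp only [incl_delta, delta_mul_delta, h]

/-- An equivariance relation in the fourth variable holds if it holds for point masses. -/
lemma equivariant_right_of_delta {H : Subgroup G}
    (K : L1 G →L[ℂ] L1 G →L[ℂ] L1 G →L[ℂ] L1 G →L[ℂ] V) (l : L1 H →L[ℂ] V →L[ℂ] V)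
    (h : ∀ (x y : G) (k : H) (a b : G), K (delta x) (delta y) (delta a) (delta (b * k)) =
      l (delta k) (K (delta x) (delta y) (delta a) (delta b)))
    (x y : L1 G) (k : L1 H) (a b : L1 G) :
    K x y a (b * incl H k) = l k (K x y a b) := by
  refine eq_of_delta (f := fun x => K x y a (b * incl H k)) (g := fun x => l k (K x y a b))
    ⟨⟨by simp, fun c x => by simp⟩, by fun_prop⟩ ⟨⟨by simp, fun c x => by simp⟩, by fun_prop⟩
    (fun x => ?_) x
  refine eq_of_delta (f := fun y => K (delta x) y a (b * incl H k))
    (g := fun y => l k (K (delta x) y a b))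
    ⟨⟨by simp, fun c x => by simp⟩, by fun_prop⟩ ⟨⟨by simp, fun c x => by simp⟩, by fun_prop⟩
    (fun y => ?_) y
  refine eq_of_delta (f := fun k => K (delta x) (delta y) a (b * incl H k))
    (g := fun k => l k (K (delta x) (delta y) a b))
    ⟨⟨by simp [mul_add], fun c x => by simp [mul_smul_comm]⟩, by fun_prop⟩
    ⟨⟨by simp, fun c x => by simp⟩, by fun_prop⟩ (fun k => ?_) k
  refine eq_of_delta (f := fun a => K (delta x) (delta y) a (b * incl H (delta k)))
    (g := fun a => l (delta k) (K (delta x) (delta y) a b))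
    ⟨⟨by simp, fun c x => by simp⟩, by fun_prop⟩ ⟨⟨by simp, fun c x => by simp⟩, by fun_prop⟩
    (fun a => ?_) a
  refine eq_of_delta (f := fun b => K (delta x) (delta y) (delta a) (b * incl H (delta k)))
    (g := fun b => l (delta k) (K (delta x) (delta y) (delta a) b))
    ⟨⟨by simp [add_mul], fun c x => by simp [smul_mul_assoc]⟩, by fun_prop⟩
    ⟨⟨by simp, fun c x => by simp⟩, by fun_prop⟩ (fun b => ?_) b
  simp only [incl_delta, delta_mul_delta, h]

/-- The cocycle identity holds if it holds for point masses. -/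
lemma cocycle_of_delta (K : L1 G →L[ℂ] L1 G →L[ℂ] L1 G →L[ℂ] L1 G →L[ℂ] V)
    (h : ∀ x y z a b : G, K (delta y) (delta z) (delta (a * x)) (delta b)
      - K (delta (x * y)) (delta z) (delta a) (delta b)
      + K (delta x) (delta (y * z)) (delta a) (delta b)
      - K (delta x) (delta y) (delta a) (delta (z * b)) = 0)
    (x y z a b : L1 G) :
    K y z (a * x) b - K (x * y) z a b + K x (y * z) a b - K x y a (z * b) = 0 := by
  have h0 : ∀ (f : L1 G → V), (∀ x y, f (x + y) = f x + f y) → (∀ (c : ℂ) x, f (c • x) = c • f x) →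
      Continuous f → (∀ s, f (delta s) = 0) → ∀ a, f a = 0 := fun f h1 h2 h3 h4 =>
    eq_of_delta (g := fun _ => (0 : V)) ⟨⟨h1, h2⟩, h3⟩
      ⟨⟨fun _ _ => (add_zero 0).symm, fun c _ => (smul_zero c).symm⟩, continuous_const⟩ h4
  refine h0 (fun x => K y z (a * x) b - K (x * y) z a b + K x (y * z) a b - K x y a (z * b))
    (fun x x' => ?_) (fun c x => ?_) (by fun_prop) (fun x => ?_) x
  · simp only [map_add, mul_add, add_mul, add_apply]; abel
  · simp only [map_smul, mul_smul_comm, smul_mul_assoc, smul_apply, smul_sub, smul_add]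
  refine h0 (fun y => K y z (a * delta x) b - K (delta x * y) z a b + K (delta x) (y * z) a b
    - K (delta x) y a (z * b)) (fun x x' => ?_) (fun c x => ?_) (by fun_prop) (fun y => ?_) y
  · simp only [map_add, mul_add, add_mul, add_apply]; abel
  · simp only [map_smul, mul_smul_comm, smul_mul_assoc, smul_apply, smul_sub, smul_add]
  refine h0 (fun z => K (delta y) z (a * delta x) b - K (delta x * delta y) z a b
    + K (delta x) (delta y * z) a b - K (delta x) (delta y) a (z * b))
    (fun x x' => ?_) (fun c x => ?_) (by fun_prop) (fun z => ?_) z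
  · simp only [map_add, mul_add, add_mul, add_apply]; abel
  · simp only [map_smul, mul_smul_comm, smul_mul_assoc, smul_apply, smul_sub, smul_add]
  refine h0 (fun a => K (delta y) (delta z) (a * delta x) b - K (delta x * delta y) (delta z) a b
    + K (delta x) (delta y * delta z) a b - K (delta x) (delta y) a (delta z * b))
    (fun x x' => ?_) (fun c x => ?_) (by fun_prop) (fun a => ?_) a
  · simp only [map_add, add_mul, add_apply]; abel
  · simp only [map_smul, smul_mul_assoc, smul_apply, smul_sub, smul_add]
  refine h0 (fun b => K (delta y) (delta z) (delta a * delta x) b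
    - K (delta x * delta y) (delta z) (delta a) b
    + K (delta x) (delta y * delta z) (delta a) b
    - K (delta x) (delta y) (delta a) (delta z * b))
    (fun x x' => ?_) (fun c x => ?_) (by fun_prop) (fun b => ?_) b
  · simp only [map_add, mul_add]; abel
  · simp only [map_smul, mul_smul_comm, smul_sub, smul_add]
  simp only [delta_mul_delta, h]

end L1

/-! ### The cochain on G built from a cochain on H. -/

namespace BanachBimodule

variable {G : Type u} [Group G] {H : Subgroup G} {V : Type v} [NormedAddCommGroup V]
  [NormedSpace ℂ V]

open Classical in
/-- The extension to `G` of the cochain `T` on `H`, on point masses, along `r : G → H`. -/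
def extendFun (N : BanachBimodule (L1 H) V) (T : BL 2 (L1 H) V) (r : G → H) (x y a b : G) : V :=
  if hw : a * x * y * b ∈ H then
    N.left (L1.delta (r a)) (N.right (L1.delta ((r (a * x * y))⁻¹ * ⟨a * x * y * b, hw⟩))
      (T ![L1.delta ((r a)⁻¹ * r (a * x)), L1.delta ((r (a * x))⁻¹ * r (a * x * y))]))
  else 0

/-- Every algebra element involved is a point mass, of norm 1, so the bound is uniform in the four
group elements, as `lift₄` requires. -/
lemma norm_extendFun_le (N : BanachBimodule (L1 H) V) (T : BL 2 (L1 H) V) (r : G → H)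
    (x y a b : G) : ‖N.extendFun T r x y a b‖ ≤ ‖N.left‖ * (‖N.right‖ * ‖T‖) := by
  unfold extendFun
  split_ifs with hw
  · refine (N.left.le_opNorm₂ _ _).trans ?_
    rw [L1.norm_delta, mul_one]
    gcongr
    refine (N.right.le_opNorm₂ _ _).trans ?_
    rw [L1.norm_delta, mul_one]
    gcongr
    refine (T.le_opNorm _).trans ?_
    simp [Fin.prod_univ_two, L1.norm_delta]
  · simp only [norm_zero]
    positivity

/-- Naming the product `w` lets differently bracketed products share one element of H, free of
membership proofs. -/
lemma extendFun_of_eq (N : BanachBimodule (L1 H) V) (T : BL 2 (L1 H) V) (r : G → H)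
    {x y a b : G} {w : H} (hw : a * x * y * b = w) :
    N.extendFun T r x y a b =
      N.left (L1.delta (r a)) (N.right (L1.delta ((r (a * x * y))⁻¹ * w))
        (T ![L1.delta ((r a)⁻¹ * r (a * x)), L1.delta ((r (a * x))⁻¹ * r (a * x * y))])) := by
  have hw' : a * x * y * b ∈ H := hw ▸ w.2
  obtain rfl : w = ⟨_, hw'⟩ := Subtype.ext hw.symm
  exact dif_pos hw'

lemma extendFun_of_notMem (N : BanachBimodule (L1 H) V) (T : BL 2 (L1 H) V) (r : G → H)
    {x y a b : G} (hw : a * x * y * b ∉ H) : N.extendFun T r x y a b = 0 :=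
  dif_neg hw

/-- Passing from a to ka multiplies r(a), r(ax), r(axy) and w on the left by k. All quotients are
unchanged, and only the outer factor r(a) gains k. -/
lemma extendFun_mul_left (N : BanachBimodule (L1 H) V) (T : BL 2 (L1 H) V) {r : G → H}
    (hr : ∀ (h : H) g, r (h * g) = h * r g) (x y : G) (k : H) (a b : G) :
    N.extendFun T r x y (k * a) b = N.left (L1.delta k) (N.extendFun T r x y a b) := by
  have heq : (k : G) * a * x * y * b = k * (a * x * y * b) := by simp only [mul_assoc]
  by_cases hw : a * x * y * b ∈ H
  · rw [N.extendFun_of_eq T r (w := ⟨_, hw⟩) rfl,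
      N.extendFun_of_eq T r (w := k * ⟨_, hw⟩) heq, ← N.left_mul, L1.delta_mul_delta,
      hr, mul_assoc (k : G) a x, hr, mul_assoc (k : G) (a * x) y, hr]
    simp only [mul_inv_rev, mul_assoc, inv_mul_cancel_left]
  · rw [N.extendFun_of_notMem T r hw, N.extendFun_of_notMem T r, map_zero]
    rwa [heq, H.mul_mem_cancel_left k.2]

/-- Only w depends on b, and it gains k on the right; no equivariance of r is involved. -/
lemma extendFun_mul_right (N : BanachBimodule (L1 H) V) (T : BL 2 (L1 H) V) (r : G → H)
    (x y : G) (k : H) (a b : G) :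
    N.extendFun T r x y a (b * k) = N.right (L1.delta k) (N.extendFun T r x y a b) := by
  have heq : a * x * y * (b * k) = a * x * y * b * k := by simp only [mul_assoc]
  by_cases hw : a * x * y * b ∈ H
  · rw [N.extendFun_of_eq T r (w := ⟨_, hw⟩) rfl,
      N.extendFun_of_eq T r (w := ⟨_, hw⟩ * k) heq, ← N.left_right, ← N.right_mul,
      L1.delta_mul_delta, ← mul_assoc (r (a * x * y))⁻¹]
  · rw [N.extendFun_of_notMem T r hw, N.extendFun_of_notMem T r, map_zero]
    rwa [heq, H.mul_mem_cancel_right k.2]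

/-- The four terms have the same product w. With p, q, s, t the values of r at a, ax, axy, axyz, the
sum is the cocycle identity of T at (p⁻¹q, q⁻¹s, s⁻¹t), multiplied by p on the left and t⁻¹w on the
right. This works for any function r. -/
lemma extendFun_cocycle (N : BanachBimodule (L1 H) V) {T : BL 2 (L1 H) V}
    (hT : T ∈ N.cocycles 2) (r : G → H) (x y z a b : G) :
    N.extendFun T r y z (a * x) b - N.extendFun T r (x * y) z a b
      + N.extendFun T r x (y * z) a b - N.extendFun T r x y a (z * b) = 0 := by
  rw [mem_cocycles_two_iff] at hT
  have e1 : a * (x * y) * z * b = a * x * y * z * b := by simp only [mul_assoc]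
  have e2 : a * x * (y * z) * b = a * x * y * z * b := by simp only [mul_assoc]
  have e3 : a * x * y * (z * b) = a * x * y * z * b := by simp only [mul_assoc]
  by_cases hw : a * x * y * z * b ∈ H
  · obtain ⟨w, hw⟩ : ∃ w : H, a * x * y * z * b = w := ⟨⟨_, hw⟩, rfl⟩
    rw [N.extendFun_of_eq T r hw, N.extendFun_of_eq T r (e1.trans hw),
      N.extendFun_of_eq T r (e2.trans hw), N.extendFun_of_eq T r (e3.trans hw)]
    simp only [← mul_assoc]
    generalize r a = p
    generalize r (a * x) = q
    generalize r (a * x * y) = s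
    generalize r (a * x * y * z) = t
    have h := congrArg (fun v => N.left (L1.delta p) (N.right (L1.delta (t⁻¹ * w)) v))
      (hT (L1.delta (p⁻¹ * q)) (L1.delta (q⁻¹ * s)) (L1.delta (s⁻¹ * t)))
    simp only [map_add, map_sub, map_zero, ← N.left_right, ← N.left_mul, ← N.right_mul,
      L1.delta_mul_delta] at h
    simpa [mul_assoc] using h
  · rw [N.extendFun_of_notMem T r hw, N.extendFun_of_notMem T r (e1 ▸ hw),
      N.extendFun_of_notMem T r (e2 ▸ hw), N.extendFun_of_notMem T r (e3 ▸ hw)]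
    simp

variable [CompleteSpace V]

/-- The extension to `ℓ¹(G)` of the cochain `T` on `ℓ¹(H)` along `r : G → H`. -/
def extend (N : BanachBimodule (L1 H) V) (T : BL 2 (L1 H) V) (r : G → H) :
    L1 G →L[ℂ] L1 G →L[ℂ] L1 G →L[ℂ] L1 G →L[ℂ] V :=
  L1.lift₄ (N.extendFun T r) (‖N.left‖ * (‖N.right‖ * ‖T‖)) (by positivity)
    (N.norm_extendFun_le T r)

lemma extend_delta (N : BanachBimodule (L1 H) V) (T : BL 2 (L1 H) V) (r : G → H) (x y a b : G) :
    N.extend T r (L1.delta x) (L1.delta y) (L1.delta a) (L1.delta b) =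
      N.extendFun T r x y a b :=
  L1.lift₄_delta _ _ _ _ x y a b

/-- On `ℓ¹(H)` the extension of `T`, evaluated at the unit, is `e · T · e`. -/
lemma extend_incl (N : BanachBimodule (L1 H) V) (T : BL 2 (L1 H) V) {r : G → H}
    (hr : ∀ h : H, r h = h) (x y : L1 H) :
    N.extend T r (L1.incl H x) (L1.incl H y) (L1.delta 1) (L1.delta 1) =
      N.left (L1.delta 1) (N.right (L1.delta 1) (T ![x, y])) := by
  let e : V →L[ℂ] V := N.left (L1.delta 1) ∘L N.right (L1.delta 1)
  have hu1 : ∀ x y : L1 H, T.toContinuousLinearMap ![0, y] 0 x = T ![x, y] := fun x y => by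
    change T (Function.update ![0, y] 0 x) = _
    congr 1; ext1 i; fin_cases i <;> rfl
  have hu2 : ∀ x y : L1 H, T.toContinuousLinearMap ![x, 0] 1 y = T ![x, y] := fun x y => by
    change T (Function.update ![x, 0] 1 y) = _
    congr 1; ext1 i; fin_cases i <;> rfl
  rw [← hu1]
  refine L1.eq_of_delta
    (f := fun x => N.extend T r (L1.incl H x) (L1.incl H y) (L1.delta 1) (L1.delta 1))
    (g := fun x => e (T.toContinuousLinearMap ![0, y] 0 x))
    ⟨⟨by simp, fun c x => by simp⟩, by fun_prop⟩
    ⟨(e ∘L T.toContinuousLinearMap ![0, y] 0).toLinearMap.isLinear, by fun_prop⟩ (fun x => ?_) x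
  simp only [hu1, ← hu2]
  refine L1.eq_of_delta
    (f := fun y => N.extend T r (L1.incl H (L1.delta x)) (L1.incl H y) (L1.delta 1) (L1.delta 1))
    (g := fun y => e (T.toContinuousLinearMap ![L1.delta x, 0] 1 y))
    ⟨⟨by simp, fun c x => by simp⟩, by fun_prop⟩
    ⟨(e ∘L T.toContinuousLinearMap ![L1.delta x, 0] 1).toLinearMap.isLinear, by fun_prop⟩
    (fun y => ?_) y
  -- At a = b = 1 and x, y in H one has r(axy) = xy = w, so both outer factors are the point mass at
  -- 1.
  have h1 : r 1 = 1 := by simpa using hr 1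
  have h2 : r ((x : G) * y) = x * y := by simpa using hr (x * y)
  rw [hu2, L1.incl_delta, L1.incl_delta, extend_delta,
    N.extendFun_of_eq T r (w := x * y) (by simp)]
  simp [h1, h2, hr, e]

end BanachBimodule

end

/-- Let `H` be a subgroup of a discrete group `G`. If `H²_app(ℓ¹(G), X*) = 0` for every Banach
`ℓ¹(G)`-bimodule `X`, then `H²_app(ℓ¹(H), X*) = 0` for every Banach `ℓ¹(H)`-bimodule `X`. -/
theorem mainTheorem7 {G : Type u} [Group G] (H : Subgroup G)
    (hG : ∀ (X : Type (max u v)) [NormedAddCommGroup X] [NormedSpace ℂ X] [CompleteSpace X]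
      (M : BanachBimodule (L1 G) X), Subsingleton (HApp 2 M.dual)) :
    ∀ (X : Type (max u v)) [NormedAddCommGroup X] [NormedSpace ℂ X] [CompleteSpace X]
      (M : BanachBimodule (L1 H) X), Subsingleton (HApp 2 M.dual) := by
  intro X _ _ _ M
  rw [BanachBimodule.subsingleton_HApp_iff]
  intro T hT
  obtain ⟨r, hr, hr'⟩ := H.exists_equivariant_retraction
  have h1 := M.dual.coboundaries_le_strongClosure 2
    (M.dual.sub_unit_compression_mem_coboundaries L1.one_mul_delta L1.mul_one_delta hT)
  -- It remains to approximate the compression 1 · T · 1 by coboundaries.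
  refine (Submodule.sub_mem_iff_left _ ?_).1 h1
  refine BanachBimodule.mem_strongClosure_coboundaries_of_lift hG M (L1.incl H) (L1.incl_mul H)
    L1.one_mul_delta L1.mul_one_delta (M.dual.extend T r)
    (L1.equivariant_left_of_delta _ M.dual.left fun x y k a b => ?_)
    (L1.equivariant_right_of_delta _ M.dual.right fun x y k a b => ?_)
    (L1.cocycle_of_delta _ fun x y z a b => ?_) fun m => ?_
  · simp only [BanachBimodule.extend_delta, M.dual.extendFun_mul_left T hr]
  · simp only [BanachBimodule.extend_delta, M.dual.extendFun_mul_right T r]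
  · simp only [BanachBimodule.extend_delta, M.dual.extendFun_cocycle hT r]
  · obtain ⟨x, y, rfl⟩ : ∃ x y, m = ![x, y] := ⟨m 0, m 1, by ext1 i; fin_cases i <;> rfl⟩
    exact (M.dual.extend_incl T hr' x y).symm
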